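/- Let $\mathcal H$ be a complex Hilbert space with an orthonormal basis $\{b_n\}_{n=1}^\infty$, and let $K=\mathrm{diag}\{1,\frac12,\frac13,\dots\}$ be the bounded operator on $\mathcal H$ with $Kb_n=\frac1n b_n$ for all $n\ge 1$. Call a sequence $\{f_n\}_{n=1}^\infty$ in $\mathcal H$ a Schauder basis if for every $x\in\mathcal H$ there is exactly one sequence of complex numbers $\{\alpha_n\}_{n=1}^\infty$ such that $\sum_{n=1}^N\alpha_n f_n\to x$ in norm as $N\to\infty$; call a Schauder basis unconditional if for every $x\in\mathcal H$ this expansion converges unconditionally, and conditional otherwise. Then $K$ is compact and is a conditional operator: there is an orthonormal basis $\{e_n\}_{n=1}^\infty$ of $\mathcal H$ such that $\{Ke_n\}_{n=1}^\infty$ is a conditional Schauder basis of $\mathcal H$. -/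

import Mathlib

open Filter Topology

/-- The partial sums `∑_{n < N} α n • f n` converge to `x` in norm. -/
def SeriesConvergesTo {H : Type*} [NormedAddCommGroup H] [NormedSpace ℂ H]
    (f : ℕ → H) (α : ℕ → ℂ) (x : H) : Prop :=
  Tendsto (fun N : ℕ => ∑ n ∈ Finset.range N, α n • f n) atTop (𝓝 x)

/-- A sequence is a Schauder basis if every vector is the norm limit of the partial sums of
`∑ α n • f n` for exactly one coefficient sequence `α`. -/
def IsSchauderBasis {H : Type*} [NormedAddCommGroup H] [NormedSpace ℂ H] (f : ℕ → H) : Prop :=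
  ∀ x : H, ∃! α : ℕ → ℂ, SeriesConvergesTo f α x

/-- A Schauder basis is unconditional if the expansion of every vector converges
unconditionally. -/
def IsUnconditionalBasis {H : Type*} [NormedAddCommGroup H] [NormedSpace ℂ H]
    (f : ℕ → H) : Prop :=
  IsSchauderBasis f ∧
    ∀ (x : H) (α : ℕ → ℂ), SeriesConvergesTo f α x → Summable (fun n => α n • f n)

/-- A conditional basis is a Schauder basis that is not unconditional. -/
def IsConditionalBasis {H : Type*} [NormedAddCommGroup H] [NormedSpace ℂ H]
    (f : ℕ → H) : Prop :=
  IsSchauderBasis f ∧ ¬ IsUnconditionalBasis f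

/-- A conditional operator is one that maps some orthonormal basis onto a conditional basis. -/
def IsConditionalOperator {H : Type*} [NormedAddCommGroup H] [InnerProductSpace ℂ H]
    (T : H →L[ℂ] H) : Prop :=
  ∃ e : HilbertBasis ℕ ℂ H, IsConditionalBasis (fun n => T (e n))

theorem memℓp_two_mul_of_bounded {d : ℕ → ℂ} {C : ℝ} (hd : ∀ n, ‖d n‖ ≤ C)
    (x : lp (fun _ : ℕ => ℂ) 2) : Memℓp (fun n => d n * x n) 2 := by
  have hx : Memℓp (fun n => (C : ℂ) * x n) 2 := (lp.memℓp x).const_mul (C : ℂ)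
  refine hx.mono' fun n => ?_
  rw [norm_mul, norm_mul]
  exact mul_le_mul_of_nonneg_right ((hd n).trans (by simpa using le_abs_self C)) (norm_nonneg _)

/-- The operator on `ℓ²` that multiplies the `n`-th coordinate by `d n`, for bounded `d`. -/
noncomputable def ellTwoDiagonal (d : ℕ → ℂ) (C : ℝ) (hd : ∀ n, ‖d n‖ ≤ C) :
    lp (fun _ : ℕ => ℂ) 2 →L[ℂ] lp (fun _ : ℕ => ℂ) 2 :=
  LinearMap.mkContinuous
    { toFun := fun x => ⟨fun n => d n * x n, memℓp_two_mul_of_bounded hd x⟩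
      map_add' := fun x y => by
        ext n
        exact mul_add (d n) (x n) (y n)
      map_smul' := fun c x => by
        ext n
        exact mul_left_comm (d n) c (x n) }
    C
    (fun x => by
      have hC : 0 ≤ C := (norm_nonneg (d 0)).trans (hd 0)
      have h : ‖(⟨fun n => d n * x n, memℓp_two_mul_of_bounded hd x⟩ :
          lp (fun _ : ℕ => ℂ) 2)‖ ≤ ‖(C : ℂ) • x‖ := by
        refine lp.norm_mono (by norm_num) fun n => ?_
        change ‖d n * x n‖ ≤ ‖(C : ℂ) * x n‖
        rw [norm_mul, norm_mul]
        exact mul_le_mul_of_nonneg_right ((hd n).trans (by simpa using le_abs_self C))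
          (norm_nonneg _)
      refine h.trans (le_of_eq ?_)
      rw [norm_smul, Complex.norm_real, Real.norm_of_nonneg hC])

/-- The bounded operator `diag (d 0, d 1, …)` with respect to the orthonormal basis `b`. -/
noncomputable def diagonalOperator {H : Type*} [NormedAddCommGroup H] [InnerProductSpace ℂ H]
    (b : HilbertBasis ℕ ℂ H) (d : ℕ → ℂ) (C : ℝ) (hd : ∀ n, ‖d n‖ ≤ C) : H →L[ℂ] H :=
  (b.repr.symm.toContinuousLinearEquiv : lp (fun _ : ℕ => ℂ) 2 →L[ℂ] H) ∘L
    ellTwoDiagonal d C hd ∘L (b.repr.toContinuousLinearEquiv : H →L[ℂ] lp (fun _ : ℕ => ℂ) 2)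

theorem diagonalOperator_apply_basis {H : Type*} [NormedAddCommGroup H] [InnerProductSpace ℂ H]
    (b : HilbertBasis ℕ ℂ H) (d : ℕ → ℂ) (C : ℝ) (hd : ∀ n, ‖d n‖ ≤ C) (n : ℕ) :
    diagonalOperator b d C hd (b n) = d n • b n := by
  apply b.repr.injective
  ext m
  have h : b.repr (diagonalOperator b d C hd (b n)) m = d m * b.repr (b n) m := by
    simp [diagonalOperator, ellTwoDiagonal]
  rw [h, map_smul, lp.coeFn_smul, Pi.smul_apply, smul_eq_mul, b.repr_self]
  by_cases hmn : m = n
  · rw [hmn]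
  · simp [lp.single_apply, hmn]

theorem norm_inv_succ_le_one (n : ℕ) : ‖(1 / ((n : ℂ) + 1))‖ ≤ 1 := by
  have h : ‖((n : ℂ) + 1)‖ = (n : ℝ) + 1 := by
    exact_mod_cast Complex.norm_natCast (n + 1)
  rw [norm_div, norm_one, h]
  exact (div_le_one (by positivity)).2 (by linarith [(Nat.cast_nonneg n : (0 : ℝ) ≤ n)])

/-- The operator `K = diag (1, 1/2, 1/3, …)` with respect to the orthonormal basis `b`
(indexed from `0`). -/
noncomputable def harmonicDiagonal {H : Type*} [NormedAddCommGroup H] [InnerProductSpace ℂ H]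
    (b : HilbertBasis ℕ ℂ H) : H →L[ℂ] H :=
  diagonalOperator b (fun n => 1 / ((n : ℂ) + 1)) 1 norm_inv_succ_le_one

/-! Compactness is approximation in norm by finite-rank truncations. Conditionality is built block
by block, because `K` respects the orthogonal splitting of the space along consecutive intervals of
indices.

The finite-dimensional model is the matrix `[[1, 0], [A, 1]]` with even and odd coordinates
interleaved, where `A` is lower triangular Toeplitz with entries `ε / (d + 1)` and `ε² (1 + ⋯ + 1/N)
= 1`. Truncating a sum of its columns only brings in a corner of `A`, whose squared Hilbert–Schmidt
norm is at most `2`, so the basis constants stay bounded. Yet `A` maps the constant vector to one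
with entries of order `√(log N)`, so dropping the odd columns can inflate a sum arbitrarily
(`exists_linearMap_conditional`).

Norms under an injective `T` depend only on its right singular vectors and singular values. Up to a
common scale and a factor of two, these values are distinct terms of any tail of the harmonic
sequence (`exists_injective_harmonic_approx`). Sending singular vectors to the matching `b i` makes
`K` imitate `T` (`exists_linearIsometry_norm_equiv`), and the image of the standard basis, completed
by unused `b i`, is a block (`exists_conditional_block`).

Gluing the blocks gives an orthonormal basis whose image under `K` has bounded basis constant, hence
is a Schauder basis. Block vectors of norm at most `2⁻ʲ` with subsums of norm at least `1` add up to
a vector whose expansion is not unconditional. -/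

/-! ### Coordinates and compactness of the diagonal operator. -/

theorem repr_harmonicDiagonal {H : Type*} [NormedAddCommGroup H] [InnerProductSpace ℂ H]
    (b : HilbertBasis ℕ ℂ H) (x : H) (m : ℕ) :
    b.repr (harmonicDiagonal b x) m = 1 / ((m : ℂ) + 1) * b.repr x m := by
  simp [harmonicDiagonal, diagonalOperator, ellTwoDiagonal]

theorem harmonicDiagonal_apply_basis {H : Type*} [NormedAddCommGroup H] [InnerProductSpace ℂ H]
    (b : HilbertBasis ℕ ℂ H) (n : ℕ) :
    harmonicDiagonal b (b n) = (1 / ((n : ℂ) + 1)) • b n :=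
  diagonalOperator_apply_basis b _ _ _ n

theorem isCompactOperator_harmonicDiagonal {H : Type*} [NormedAddCommGroup H]
    [InnerProductSpace ℂ H] [CompleteSpace H] (b : HilbertBasis ℕ ℂ H) :
    IsCompactOperator (harmonicDiagonal b) := by
  -- Truncation to the first `N` diagonal entries; the remainder has norm at most `1 / (N + 1)`, its
  -- first entry.
  let F : ℕ → H →L[ℂ] H := fun N =>
    ∑ n ∈ Finset.range N, ((innerSL ℂ (b n)).smulRight ((1 / ((n : ℂ) + 1)) • b n))
  have hFc : ∀ N, IsCompactOperator (F N) := by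
    intro N
    have h1 : ∀ (n : ℕ), ((innerSL ℂ (b n)).smulRight ((1 / ((n : ℂ) + 1)) • b n)) ∈
        compactOperator (RingHom.id ℂ) H H := by
      intro n
      have : IsCompactOperator (ContinuousLinearMap.toSpanSingleton ℂ
          ((1 / ((n : ℂ) + 1)) • b n)) :=
        isCompactOperator_of_locallyCompactSpace_rng
          (ContinuousLinearMap.toSpanSingleton ℂ ((1 / ((n : ℂ) + 1)) • b n))
      exact this.comp_clm (innerSL ℂ (b n))
    exact Submodule.sum_mem _ fun n _ => h1 n
  have hF : ∀ N x m, b.repr (F N x) m = if m < N then 1 / ((m : ℂ) + 1) * b.repr x m else 0 := by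
    intro N x m
    rw [b.repr_apply_apply]
    simp only [F, sum_apply, ContinuousLinearMap.smulRight_apply, inner_sum,
      inner_smul_right, innerSL_apply_apply, orthonormal_iff_ite.1 b.orthonormal]
    simp [b.repr_apply_apply, mul_comm]
  have hlim : Tendsto F atTop (𝓝 (harmonicDiagonal b)) := by
    rw [tendsto_iff_norm_sub_tendsto_zero]
    refine squeeze_zero (fun _ => norm_nonneg _) (fun N => ?_)
      (tendsto_one_div_add_atTop_nhds_zero_nat (𝕜 := ℝ))
    refine ContinuousLinearMap.opNorm_le_bound _ (by positivity) fun x => ?_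
    rw [← b.repr.norm_map, ← b.repr.norm_map x]
    have h : ‖b.repr ((F N - harmonicDiagonal b) x)‖ ≤ ‖((1 / ((N : ℝ) + 1) : ℝ) : ℂ) • b.repr x‖ := by
      refine lp.norm_mono (by norm_num) fun m => ?_
      have e1 : b.repr ((F N - harmonicDiagonal b) x) m
          = b.repr (F N x) m - b.repr (harmonicDiagonal b x) m := by
        simp
      rw [e1, hF, repr_harmonicDiagonal]
      simp only [lp.coeFn_smul, Pi.smul_apply, norm_smul]
      split_ifs with h
      · simp; positivity
      · rw [zero_sub, norm_neg, norm_mul]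
        refine mul_le_mul_of_nonneg_right ?_ (norm_nonneg _)
        have h2 : ‖((m : ℂ) + 1)‖ = (m : ℝ) + 1 := by exact_mod_cast Complex.norm_natCast (m + 1)
        rw [norm_div, norm_one, h2, Complex.norm_real, Real.norm_of_nonneg (by positivity)]
        have : (N : ℝ) ≤ m := by exact_mod_cast not_lt.1 h
        gcongr
    refine h.trans (le_of_eq ?_)
    rw [norm_smul, Complex.norm_real, Real.norm_of_nonneg (by positivity)]
  exact isCompactOperator_of_tendsto hlim (Eventually.of_forall hFc)

/-! ### Schauder bases from biorthogonal systems. -/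

/-- A sequence with continuous biorthogonal functionals, dense span and uniformly bounded
partial sums is a Schauder basis, with expansion coefficients given by the functionals. -/
theorem seriesConvergesTo_of_biorthogonal {H : Type*} [NormedAddCommGroup H] [NormedSpace ℂ H]
    {f : ℕ → H} {g : ℕ → H →L[ℂ] ℂ} (hgf : ∀ m n, g m (f n) = if m = n then 1 else 0)
    (hd : Dense (Submodule.span ℂ (Set.range f) : Set H)) {C : ℝ}
    (hC : ∀ (α : ℕ → ℂ) (N N' : ℕ), N ≤ N' →
      ‖∑ n ∈ Finset.range N, α n • f n‖ ≤ C * ‖∑ n ∈ Finset.range N', α n • f n‖) (x : H) :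
    SeriesConvergesTo f (fun n => g n x) x := by
  -- On the algebraic span the partial sums are eventually stationary.
  have key : ∀ y ∈ Submodule.span ℂ (Set.range f),
      ∃ N₀, ∀ N, N₀ ≤ N → ∑ n ∈ Finset.range N, g n y • f n = y := by
    intro y hy
    induction hy using Submodule.span_induction with
    | mem y hy =>
      obtain ⟨k, rfl⟩ := hy
      refine ⟨k + 1, fun N hN => ?_⟩
      rw [Finset.sum_eq_single k]
      · simp [hgf]
      · intro m _ hm; simp [hgf, hm]
      · intro h; exact absurd (Finset.mem_range.2 hN) h
    | zero => exact ⟨0, fun N _ => by simp⟩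
    | add y z _ _ hy hz =>
      obtain ⟨N₁, h₁⟩ := hy
      obtain ⟨N₂, h₂⟩ := hz
      refine ⟨max N₁ N₂, fun N hN => ?_⟩
      simp only [map_add, add_smul, Finset.sum_add_distrib]
      rw [h₁ N (le_trans (le_max_left _ _) hN), h₂ N (le_trans (le_max_right _ _) hN)]
    | smul c y _ hy =>
      obtain ⟨N₁, h₁⟩ := hy
      refine ⟨N₁, fun N hN => ?_⟩
      simp only [map_smul, smul_assoc, ← Finset.smul_sum]
      rw [h₁ N hN]
  -- The bound on partial sums is a closed condition, so it passes from the dense span to every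
  -- vector.
  have hbd : ∀ N y, ‖∑ n ∈ Finset.range N, g n y • f n‖ ≤ C * ‖y‖ := by
    intro N y
    have hcl : IsClosed {y : H | ‖∑ n ∈ Finset.range N, g n y • f n‖ ≤ C * ‖y‖} :=
      isClosed_le (by fun_prop) (by fun_prop)
    have hsub : (Submodule.span ℂ (Set.range f) : Set H) ⊆
        {y : H | ‖∑ n ∈ Finset.range N, g n y • f n‖ ≤ C * ‖y‖} := by
      intro y hy
      obtain ⟨N₀, h⟩ := key y hy
      have := hC (fun n => g n y) N (max N N₀) (le_max_left _ _)
      rwa [h _ (le_max_right _ _)] at this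
    have h1 := hcl.closure_subset_iff.2 hsub
    rw [hd.closure_eq] at h1
    exact h1 (Set.mem_univ y)
  rw [SeriesConvergesTo, Metric.tendsto_atTop]
  intro ε hε
  have hC' : 0 < |C| + 1 := by positivity
  obtain ⟨y, hy, hxy⟩ := hd.exists_dist_lt x (ε := ε / (|C| + 1)) (by positivity)
  obtain ⟨N₀, h⟩ := key y hy
  refine ⟨N₀, fun N hN => ?_⟩
  have e : ∑ n ∈ Finset.range N, g n x • f n - x
      = ∑ n ∈ Finset.range N, g n (x - y) • f n + (y - x) := by
    simp only [map_sub, sub_smul, Finset.sum_sub_distrib, h N hN]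
    abel
  rw [dist_eq_norm, e]
  rw [dist_eq_norm] at hxy
  calc _ ≤ C * ‖x - y‖ + ‖x - y‖ := (norm_add_le _ _).trans
        (add_le_add (hbd N _) (norm_sub_rev _ _).le)
    _ ≤ (|C| + 1) * ‖x - y‖ := by nlinarith [le_abs_self C, norm_nonneg (x - y)]
    _ < ε := by rwa [lt_div_iff₀' hC'] at hxy

/-- Applying the continuous functional `g m` to the partial sums gives a sequence eventually equal
to `α m`. -/
theorem SeriesConvergesTo.eq_of_biorthogonal {H : Type*} [NormedAddCommGroup H] [NormedSpace ℂ H]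
    {f : ℕ → H} {g : ℕ → H →L[ℂ] ℂ} (hgf : ∀ m n, g m (f n) = if m = n then 1 else 0)
    {α : ℕ → ℂ} {x : H} (h : SeriesConvergesTo f α x) : α = fun n => g n x := by
  funext m
  have h1 : Tendsto (fun N => g m (∑ n ∈ Finset.range N, α n • f n)) atTop (𝓝 (g m x)) :=
    ((g m).continuous.tendsto x).comp h
  refine tendsto_nhds_unique (tendsto_const_nhds.congr' ?_) h1
  filter_upwards [eventually_gt_atTop m] with N hN
  simp [hgf, hN]

theorem isSchauderBasis_of_biorthogonal {H : Type*} [NormedAddCommGroup H] [NormedSpace ℂ H]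
    {f : ℕ → H} {g : ℕ → H →L[ℂ] ℂ} (hgf : ∀ m n, g m (f n) = if m = n then 1 else 0)
    (hd : Dense (Submodule.span ℂ (Set.range f) : Set H)) {C : ℝ}
    (hC : ∀ (α : ℕ → ℂ) (N N' : ℕ), N ≤ N' →
      ‖∑ n ∈ Finset.range N, α n • f n‖ ≤ C * ‖∑ n ∈ Finset.range N', α n • f n‖) :
    IsSchauderBasis f := fun x =>
  ⟨fun n => g n x, seriesConvergesTo_of_biorthogonal hgf hd hC x,
    fun _ h => h.eq_of_biorthogonal hgf⟩

/-- A Schauder basis is not unconditional if, on finite sets of indices escaping to infinity,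
there are vectors of small norm with subsums of norm at least one. -/
theorem not_isUnconditionalBasis_of_biorthogonal {H : Type*} [NormedAddCommGroup H]
    [NormedSpace ℂ H] [CompleteSpace H]
    {f : ℕ → H} {g : ℕ → H →L[ℂ] ℂ} (hgf : ∀ m n, g m (f n) = if m = n then 1 else 0)
    (hd : Dense (Submodule.span ℂ (Set.range f) : Set H)) {C : ℝ}
    (hC : ∀ (α : ℕ → ℂ) (N N' : ℕ), N ≤ N' →
      ‖∑ n ∈ Finset.range N, α n • f n‖ ≤ C * ‖∑ n ∈ Finset.range N', α n • f n‖)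
    {B : ℕ → Finset ℕ} (hBdisj : ∀ i j, i ≠ j → Disjoint (B i) (B j))
    (hB : ∀ j, ∀ n ∈ B j, j ≤ n)
    (hbad : ∀ j, ∃ α : ℕ → ℂ, ‖∑ n ∈ B j, α n • f n‖ ≤ (1 / 2) ^ j ∧
      ∃ S ⊆ B j, 1 ≤ ‖∑ n ∈ S, α n • f n‖) :
    ¬ IsUnconditionalBasis f := by
  rintro ⟨-, hu⟩
  choose α hα S hS hS1 using hbad
  -- The bad vectors are summed over all blocks; disjointness of the blocks lets `g n` recover the
  -- coefficients of each one.
  let x : ℕ → H := fun j => ∑ n ∈ B j, α j n • f n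
  have hx : Summable x :=
    Summable.of_norm_bounded (summable_geometric_two) hα
  have hgx : ∀ j n, n ∈ B j → g n (∑' i, x i) = α j n := by
    intro j n hn
    rw [(g n).map_tsum hx, tsum_eq_single j]
    · simp [x, hgf, hn]
    · intro i hi
      have : n ∉ B i := fun h => Finset.disjoint_left.1 (hBdisj i j hi) h hn
      simp [x, hgf, this]
  have hsum := hu _ _ (seriesConvergesTo_of_biorthogonal hgf hd hC (∑' i, x i))
  obtain ⟨s, hs⟩ := summable_iff_vanishing_norm.1 hsum 1 one_pos
  -- A block starting beyond `s`: its subsum of norm at least `1` violates the Cauchy criterion for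
  -- summability.
  let j := s.sup id + 1
  have hdis : Disjoint (S j) s := by
    rw [Finset.disjoint_left]
    intro n hn hns
    have h1 := hB j n (hS j hn)
    have h2 : n ≤ s.sup id := Finset.le_sup (f := id) hns
    omega
  have h3 := hs (S j) hdis
  rw [Finset.sum_congr rfl fun n hn => by rw [hgx j n (hS j hn)]] at h3
  exact absurd (hS1 j) (not_le.2 h3)

/-! ### Singular values and their approximation by harmonic terms. -/

/-- Singular values of an injective linear map on a finite-dimensional Euclidean space. -/
theorem exists_orthonormalBasis_norm_sq_eq {n : ℕ} {F : Type*} [NormedAddCommGroup F]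
    [InnerProductSpace ℂ F] [FiniteDimensional ℂ F] (T : EuclideanSpace ℂ (Fin n) →ₗ[ℂ] F)
    (hT : Function.Injective T) :
    ∃ (v : OrthonormalBasis (Fin n) ℂ (EuclideanSpace ℂ (Fin n))) (s : Fin n → ℝ),
      (∀ i, 0 < s i) ∧ ∀ α, ‖T α‖ ^ 2 = ∑ i, s i ^ 2 * ‖inner ℂ (v i) α‖ ^ 2 := by
  have hs : (T.adjoint ∘ₗ T).IsSymmetric := (LinearMap.isPositive_adjoint_comp_self T).isSymmetric
  have hn : Module.finrank ℂ (EuclideanSpace ℂ (Fin n)) = n := by simp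
  -- An eigenbasis of `T* T`; the eigenvalue at `v i` is `‖T (v i)‖ ^ 2`, positive by injectivity.
  let v := hs.eigenvectorBasis hn
  have hv : ∀ i, T.adjoint (T (v i)) = (hs.eigenvalues hn i : ℂ) • v i :=
    fun i => hs.apply_eigenvectorBasis hn i
  have hin : ∀ i j, inner ℂ (T (v i)) (T (v j)) = (hs.eigenvalues hn j : ℂ) * inner ℂ (v i) (v j) := by
    intro i j
    rw [← LinearMap.adjoint_inner_right, hv, inner_smul_right]
  have hself : ∀ i, (hs.eigenvalues hn i) = ‖T (v i)‖ ^ 2 := by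
    intro i
    have h := hin i i
    rw [inner_self_eq_norm_sq_to_K, inner_self_eq_norm_sq_to_K, v.orthonormal.1 i] at h
    simp only [Complex.coe_algebraMap, Complex.ofReal_one, one_pow, mul_one] at h
    exact_mod_cast h.symm
  refine ⟨v, fun i => ‖T (v i)‖, fun i => ?_, fun α => ?_⟩
  · rw [norm_pos_iff]
    intro h
    have : v i = 0 := hT (by rw [h, map_zero])
    exact v.orthonormal.ne_zero i this
  · have e : T.adjoint (T α) = ∑ i, inner ℂ (v i) α • ((hs.eigenvalues hn i : ℂ) • v i) := by
      conv_lhs => rw [← v.sum_repr' α]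
      simp only [map_sum, map_smul, hv]
    have h1 : (inner ℂ (T α) (T α) : ℂ) = ∑ i, ((‖T (v i)‖ ^ 2 * ‖inner ℂ (v i) α‖ ^ 2 : ℝ) : ℂ) := by
      rw [← LinearMap.adjoint_inner_right, e, inner_sum]
      refine Finset.sum_congr rfl fun i _ => ?_
      rw [inner_smul_right, inner_smul_right, hself i, ← inner_conj_symm α (v i), mul_left_comm,
        Complex.mul_conj']
      push_cast
      rfl
    rw [inner_self_eq_norm_sq_to_K] at h1
    refine Complex.ofReal_injective ?_
    rw [Complex.ofReal_sum, ← h1, Complex.ofReal_pow]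
    rfl

/-- Finitely many positive numbers are, up to a common scale and a factor of two, distinct members
of any tail of the harmonic sequence. -/
theorem exists_injective_harmonic_approx {n : ℕ} {s : Fin n → ℝ} (hs : ∀ i, 0 < s i) (N₀ : ℕ) :
    ∃ (idx : Fin n → ℕ) (c : ℝ), Function.Injective idx ∧ 0 < c ∧
      ∀ i, N₀ ≤ idx i ∧ c * s i ≤ 1 / ((idx i : ℝ) + 1) ∧ 1 / ((idx i : ℝ) + 1) ≤ 2 * (c * s i) := by
  rcases Nat.eq_zero_or_pos n with rfl | hn
  · exact ⟨fun i => i.elim0, 1, fun i => i.elim0, one_pos, fun i => i.elim0⟩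
  let R : ℝ := (N₀ + 2) * ∑ i, s i
  have hsum : ∀ i, s i ≤ ∑ i, s i :=
    fun i => Finset.single_le_sum (fun j _ => (hs j).le) (Finset.mem_univ i)
  have hR : ∀ i, (N₀ : ℝ) + 2 ≤ R / s i := by
    intro i
    rw [le_div_iff₀ (hs i)]
    exact mul_le_mul_of_nonneg_left (hsum i) (by positivity)
  have hRpos : 0 < R := by
    have := hs ⟨0, hn⟩
    have := hsum ⟨0, hn⟩
    have : 0 < ∑ i, s i := by linarith
    positivity
  have hn' : (1 : ℝ) ≤ n := by exact_mod_cast hn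
  -- The residue modulo `n` makes the indices distinct. Since `R / s i ≥ 2`, the index plus one lies
  -- between `n * R / s i` and twice that, whence the value of `c`.
  refine ⟨fun i => n * ⌈R / s i⌉₊ + i, 1 / (2 * n * R), ?_, by positivity, fun i => ?_⟩
  · intro i j h
    have h2 := congrArg (· % n) h
    simp only [Nat.mul_add_mod, Nat.mod_eq_of_lt i.2, Nat.mod_eq_of_lt j.2] at h2
    exact Fin.ext h2
  · have h1 : R / s i ≤ ⌈R / s i⌉₊ := Nat.le_ceil _
    have h2 : (⌈R / s i⌉₊ : ℝ) < R / s i + 1 := Nat.ceil_lt_add_one (by have := hs i; positivity)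
    have h3 := hR i
    have hi : ((i : ℕ) : ℝ) + 1 ≤ n := by exact_mod_cast i.2
    have hi0 : (0 : ℝ) ≤ ((i : ℕ) : ℝ) := by positivity
    have hN : (0 : ℝ) ≤ N₀ := by positivity
    have hlow : (n : ℝ) * (R / s i) ≤ n * ⌈R / s i⌉₊ := by gcongr
    have hup : (n : ℝ) * ⌈R / s i⌉₊ ≤ n * (R / s i + 1) := by gcongr
    have hsi := hs i
    have e1 : 1 / (2 * n * R) * s i = 1 / (2 * (n * (R / s i))) := by field_simp
    have e2 : 2 * (1 / (2 * n * R) * s i) = 1 / (n * (R / s i)) := by field_simp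
    have hpos : 0 < (n : ℝ) * (R / s i) := by positivity
    rw [e2, e1]
    push_cast
    refine ⟨?_, ?_, ?_⟩
    · have : (N₀ : ℝ) ≤ ((n * ⌈R / s i⌉₊ + i : ℕ) : ℝ) := by
        push_cast
        nlinarith
      exact_mod_cast this
    · apply one_div_le_one_div_of_le (by positivity)
      nlinarith
    · apply one_div_le_one_div_of_le (by positivity)
      linarith

/-! ### Truncation in the Toeplitz block matrix. -/

/-- The odd coordinates of the image of a sequence under a lower triangular Toeplitz block. -/
noncomputable def toeplitzOdd (a : ℕ → ℝ) (α : ℕ → ℂ) (k : ℕ) : ℂ :=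
  α (2 * k + 1) + ∑ n ∈ Finset.range (k + 1), (a (k - n) : ℂ) * α (2 * n)

/-- The squared norm of the image of a sequence under the block matrix `[[1, 0], [A, 1]]`, with `A`
the lower triangular Toeplitz matrix of `a`. -/
noncomputable def toeplitzNormSq (a : ℕ → ℝ) (N : ℕ) (α : ℕ → ℂ) : ℝ :=
  ∑ k ∈ Finset.range N, (‖α (2 * k)‖ ^ 2 + ‖toeplitzOdd a α k‖ ^ 2)

/-- With `M = m / 2`, odd coordinates below `M` are unchanged by the cut. In the others only the
columns `n ≤ M` of the Toeplitz part survive, and Cauchy–Schwarz bounds them by the Hilbert–Schmidt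
norm of that corner times the norm of the even coordinates. -/
theorem toeplitzNormSq_truncate_le {a : ℕ → ℝ} {N : ℕ} {D : ℝ}
    (hD : ∀ M < N, ∑ k ∈ Finset.Ico M N, ∑ n ∈ Finset.range (M + 1), a (k - n) ^ 2 ≤ D)
    (hD0 : 0 ≤ D) (α : ℕ → ℂ) (m : ℕ) :
    toeplitzNormSq a N (fun i => if i < m then α i else 0) ≤ (1 + D) * toeplitzNormSq a N α := by
  set α' : ℕ → ℂ := fun i => if i < m then α i else 0 with hα'
  have hle : ∀ i, ‖α' i‖ ≤ ‖α i‖ := by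
    intro i; simp only [hα']; split_ifs <;> simp
  let M := m / 2
  let U := ∑ n ∈ Finset.range N, ‖α (2 * n)‖ ^ 2
  have hU : U ≤ toeplitzNormSq a N α :=
    Finset.sum_le_sum fun k _ => le_add_of_nonneg_right (by positivity)
  have hU0 : 0 ≤ U := Finset.sum_nonneg fun _ _ => by positivity
  have hterm : ∀ k ∈ Finset.range N, ‖toeplitzOdd a α' k‖ ^ 2 ≤ ‖toeplitzOdd a α k‖ ^ 2 +
      (if M ≤ k then (∑ n ∈ Finset.range (M + 1), a (k - n) ^ 2) * U else 0) := by
    intro k hk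
    rw [Finset.mem_range] at hk
    split_ifs with h
    · have e : toeplitzOdd a α' k = ∑ n ∈ Finset.range (M + 1), (a (k - n) : ℂ) * α' (2 * n) := by
        rw [toeplitzOdd]
        have h0 : α' (2 * k + 1) = 0 := if_neg (by omega)
        rw [h0, zero_add]
        symm
        refine Finset.sum_subset (Finset.range_mono (by omega)) fun n _ hn => ?_
        rw [Finset.mem_range] at hn
        have h1 : α' (2 * n) = 0 := if_neg (by omega)
        rw [h1, mul_zero]
      have h1 : ‖toeplitzOdd a α' k‖ ≤ ∑ n ∈ Finset.range (M + 1), |a (k - n)| * ‖α (2 * n)‖ := by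
        rw [e]
        refine (norm_sum_le _ _).trans (Finset.sum_le_sum fun n _ => ?_)
        rw [norm_mul, Complex.norm_real, Real.norm_eq_abs]
        exact mul_le_mul_of_nonneg_left (hle _) (abs_nonneg _)
      have h2 : ‖toeplitzOdd a α' k‖ ^ 2 ≤
          (∑ n ∈ Finset.range (M + 1), a (k - n) ^ 2) * U := by
        refine (pow_le_pow_left₀ (norm_nonneg _) h1 2).trans ?_
        refine (Finset.sum_mul_sq_le_sq_mul_sq _ _ _).trans ?_
        simp only [sq_abs]
        refine mul_le_mul_of_nonneg_left ?_ (Finset.sum_nonneg fun _ _ => by positivity)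
        exact Finset.sum_le_sum_of_subset_of_nonneg (Finset.range_mono (by omega))
          fun _ _ _ => by positivity
      have : 0 ≤ ‖toeplitzOdd a α k‖ ^ 2 := by positivity
      linarith
    · have e : toeplitzOdd a α' k = toeplitzOdd a α k := by
        rw [toeplitzOdd, toeplitzOdd]
        have h0 : α' (2 * k + 1) = α (2 * k + 1) := if_pos (by omega)
        rw [h0]
        congr 1
        refine Finset.sum_congr rfl fun n hn => ?_
        rw [Finset.mem_range] at hn
        have h1 : α' (2 * n) = α (2 * n) := if_pos (by omega)
        rw [h1]
      rw [e, add_zero]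
  have hextra : ∑ k ∈ Finset.range N,
      (if M ≤ k then (∑ n ∈ Finset.range (M + 1), a (k - n) ^ 2) * U else 0) ≤ D * U := by
    rw [← Finset.sum_filter]
    have e : (Finset.range N).filter (fun k => M ≤ k) = Finset.Ico M N := by
      ext k; simp [and_comm]
    rw [e, ← Finset.sum_mul]
    refine mul_le_mul_of_nonneg_right ?_ hU0
    rcases lt_or_ge M N with h | h
    · exact hD M h
    · rw [Finset.Ico_eq_empty_of_le h]; simpa using hD0
  calc toeplitzNormSq a N α'
      ≤ ∑ k ∈ Finset.range N, ((‖α (2 * k)‖ ^ 2 + ‖toeplitzOdd a α k‖ ^ 2) +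
          (if M ≤ k then (∑ n ∈ Finset.range (M + 1), a (k - n) ^ 2) * U else 0)) := by
        refine Finset.sum_le_sum fun k hk => ?_
        have h1 := hterm k hk
        have h2 := pow_le_pow_left₀ (norm_nonneg _) (hle (2 * k)) 2
        linarith
    _ ≤ toeplitzNormSq a N α + D * U := by
        rw [Finset.sum_add_distrib]
        exact add_le_add le_rfl hextra
    _ ≤ (1 + D) * toeplitzNormSq a N α := by nlinarith

/-! ### Harmonic sums and the Hilbert–Schmidt bound. -/

/-- The harmonic sum `1 + 1/2 + ⋯ + 1/N`. -/
noncomputable def harmonicSum (N : ℕ) : ℝ := ∑ d ∈ Finset.range N, 1 / ((d : ℝ) + 1)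

theorem harmonicSum_mono : Monotone harmonicSum := fun _ _ h =>
  Finset.sum_le_sum_of_subset_of_nonneg (Finset.range_mono h) fun _ _ _ => by positivity

theorem one_le_harmonicSum {N : ℕ} (hN : 0 < N) : 1 ≤ harmonicSum N := by
  have := harmonicSum_mono hN
  simpa [harmonicSum] using this

/-- Each of the last `L` terms is at most `1 / L`. Doubling the length thus barely changes the sum,
which keeps the normalisation comparable over the upper half of the rows. -/
theorem harmonicSum_two_mul_le (L : ℕ) : harmonicSum (2 * L) ≤ harmonicSum L + 1 := by
  rw [harmonicSum, harmonicSum, two_mul, Finset.sum_range_add]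
  gcongr
  rcases Nat.eq_zero_or_pos L with rfl | hL
  · simp
  have hL' : (0 : ℝ) < L := by exact_mod_cast hL
  calc ∑ x ∈ Finset.range L, 1 / (((L + x : ℕ) : ℝ) + 1)
      ≤ ∑ x ∈ Finset.range L, 1 / (L : ℝ) := by
        refine Finset.sum_le_sum fun x _ => ?_
        apply one_div_le_one_div_of_le hL'
        push_cast
        have : (0 : ℝ) ≤ x := by positivity
        linarith
    _ = 1 := by simp; field_simp

/-- Telescoping from `1 / (d + 1)² ≤ 2 / (d + 1) - 2 / (d + 2)`, valid for `d ≥ 0`. -/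
theorem sum_Ico_inv_sq_le {M N n : ℕ} (hn : n ≤ M) (hMN : M ≤ N) :
    ∑ k ∈ Finset.Ico M N, (1 / (((k - n : ℕ) : ℝ) + 1)) ^ 2 ≤
      2 * (1 / (((M - n : ℕ) : ℝ) + 1)) - 2 * (1 / (((N - n : ℕ) : ℝ) + 1)) := by
  induction N, hMN using Nat.le_induction with
  | base => simp
  | succ N hMN ih =>
    rw [Finset.sum_Ico_succ_top hMN]
    have e : ((N + 1 - n : ℕ) : ℝ) = ((N - n : ℕ) : ℝ) + 1 := by
      rw [Nat.sub_add_comm (hn.trans hMN)]; push_cast; ring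
    rw [e]
    set d : ℝ := ((N - n : ℕ) : ℝ)
    have hd : 0 ≤ d := by positivity
    have : (1 / (d + 1)) ^ 2 ≤ 2 * (1 / (d + 1)) - 2 * (1 / (d + 1 + 1)) := by
      have e2 : 2 * (1 / (d + 1)) - 2 * (1 / (d + 1 + 1)) - (1 / (d + 1)) ^ 2
          = d / ((d + 1) ^ 2 * (d + 1 + 1)) := by field_simp; ring
      have : 0 ≤ d / ((d + 1) ^ 2 * (d + 1 + 1)) := by positivity
      linarith
    linarith

/-- Summing the corner down each column leaves about the reciprocal distance to row `M`, and these
reciprocals add up to a harmonic sum: logarithmic, not linear, growth. -/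
theorem sum_sum_sq_le {ε : ℝ} {M N : ℕ} (hMN : M < N) :
    ∑ k ∈ Finset.Ico M N, ∑ n ∈ Finset.range (M + 1), (ε * (1 / (((k - n : ℕ) : ℝ) + 1))) ^ 2 ≤
      2 * (ε ^ 2 * harmonicSum N) := by
  rw [Finset.sum_comm]
  calc _ ≤ ∑ n ∈ Finset.range (M + 1), ε ^ 2 * (2 * (1 / (((M - n : ℕ) : ℝ) + 1))) := by
        refine Finset.sum_le_sum fun n hn => ?_
        rw [Finset.mem_range] at hn
        simp only [mul_pow]
        rw [← Finset.mul_sum]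
        refine mul_le_mul_of_nonneg_left ?_ (sq_nonneg _)
        have h := sum_Ico_inv_sq_le (n := n) (by omega) hMN.le
        have : 0 ≤ 2 * (1 / (((N - n : ℕ) : ℝ) + 1)) := by positivity
        linarith
    _ = 2 * (ε ^ 2 * harmonicSum (M + 1)) := by
        rw [harmonicSum, ← Finset.sum_range_reflect (fun d : ℕ => 1 / ((d : ℝ) + 1)),
          Finset.mul_sum, Finset.mul_sum]
        refine Finset.sum_congr rfl fun n _ => ?_
        simp only [Nat.add_sub_cancel]
        ring
    _ ≤ _ := by
        have := harmonicSum_mono hMN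
        gcongr

/-! ### Finite-dimensional conditional bases. -/

/-- The zero extension of a finite vector to a sequence. -/
noncomputable def extendZero (n : ℕ) : EuclideanSpace ℂ (Fin n) →ₗ[ℂ] (ℕ → ℂ) where
  toFun x i := if h : i < n then x ⟨i, h⟩ else 0
  map_add' x y := by ext i; by_cases h : i < n <;> simp [h]
  map_smul' c x := by ext i; by_cases h : i < n <;> simp [h]

theorem extendZero_sum {n : ℕ} (α : ℕ → ℂ) (S : Finset (Fin n)) (i : ℕ) (hi : i < n) :
    extendZero n (∑ k ∈ S, α k • EuclideanSpace.single k (1 : ℂ)) i =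
      if ⟨i, hi⟩ ∈ S then α i else 0 := by
  simp [extendZero, hi]

/-- The linear map whose squared norm is `toeplitzNormSq`. -/
noncomputable def toeplitzMap (a : ℕ → ℝ) (N : ℕ) :
    EuclideanSpace ℂ (Fin (2 * N)) →ₗ[ℂ] EuclideanSpace ℂ (Fin N ⊕ Fin N) where
  toFun x := WithLp.toLp 2 (Sum.elim (fun k => extendZero _ x (2 * k))
    (fun k => toeplitzOdd a (extendZero _ x) k))
  map_add' x y := by
    ext i
    rcases i with i | i
    · simp
    · simp [toeplitzOdd, mul_add, Finset.sum_add_distrib]; ring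
  map_smul' c x := by
    ext i
    rcases i with i | i
    · simp
    · simp [toeplitzOdd, mul_add, Finset.mul_sum, mul_left_comm]

theorem norm_toeplitzMap_sq (a : ℕ → ℝ) (N : ℕ) (x : EuclideanSpace ℂ (Fin (2 * N))) :
    ‖toeplitzMap a N x‖ ^ 2 = toeplitzNormSq a N (extendZero _ x) := by
  rw [EuclideanSpace.norm_sq_eq, Fintype.sum_sum_type, toeplitzNormSq, Finset.sum_add_distrib]
  simp only [toeplitzMap, LinearMap.coe_mk, AddHom.coe_mk, Sum.elim_inl, Sum.elim_inr]
  rw [Fin.sum_univ_eq_sum_range (fun k => ‖extendZero _ x (2 * k)‖ ^ 2),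
    Fin.sum_univ_eq_sum_range (fun k => ‖toeplitzOdd a (extendZero _ x) k‖ ^ 2)]

/-- The matrix is unitriangular: the even coordinates vanish first, which removes the Toeplitz term
from the odd ones. -/
theorem toeplitzMap_injective (a : ℕ → ℝ) (N : ℕ) : Function.Injective (toeplitzMap a N) := by
  rw [injective_iff_map_eq_zero]
  intro x hx
  have h : toeplitzNormSq a N (extendZero _ x) = 0 := by
    rw [← norm_toeplitzMap_sq, hx]; simp
  rw [toeplitzNormSq, Finset.sum_eq_zero_iff_of_nonneg (fun _ _ => by positivity)] at h
  have h1 : ∀ k < N, extendZero _ x (2 * k) = 0 ∧ toeplitzOdd a (extendZero _ x) k = 0 := by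
    intro k hk
    have h2 := h k (Finset.mem_range.2 hk)
    rw [add_eq_zero_iff_of_nonneg (by positivity) (by positivity)] at h2
    simpa using h2
  have h3 : ∀ k < N, extendZero _ x (2 * k + 1) = 0 := by
    intro k hk
    have h4 := (h1 k hk).2
    rw [toeplitzOdd, Finset.sum_eq_zero, add_zero] at h4
    · exact h4
    · intro n hn
      rw [Finset.mem_range] at hn
      rw [(h1 n (by omega)).1, mul_zero]
  ext i
  have h5 : extendZero _ x i = x i := by simp [extendZero]
  rw [← h5]
  rcases Nat.even_or_odd' (i : ℕ) with ⟨c, hc | hc⟩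
  · rw [hc]; exact (h1 c (by omega)).1
  · rw [hc]; exact h3 c (by omega)

theorem toeplitzNormSq_congr {a : ℕ → ℝ} {N : ℕ} {α β : ℕ → ℂ} (h : ∀ i < 2 * N, α i = β i) :
    toeplitzNormSq a N α = toeplitzNormSq a N β := by
  refine Finset.sum_congr rfl fun k hk => ?_
  rw [Finset.mem_range] at hk
  rw [h _ (by omega), toeplitzOdd, toeplitzOdd, h (2 * k + 1) (by omega)]
  rw [Finset.sum_congr rfl fun n hn => by
    rw [h (2 * n) (by rw [Finset.mem_range] at hn; omega)]]

/-- Serves both initial segments, for the basis constant, and the even indices, for the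
unconditional constant. -/
theorem norm_toeplitzMap_sum_sq (a : ℕ → ℝ) (N : ℕ) (α : ℕ → ℂ) (p : ℕ → Prop) [DecidablePred p] :
    ‖toeplitzMap a N (∑ k ∈ Finset.univ.filter (fun k : Fin (2 * N) => p k), α k • EuclideanSpace.single k (1 : ℂ))‖ ^ 2 =
      toeplitzNormSq a N (fun i => if p i then α i else 0) := by
  rw [norm_toeplitzMap_sq]
  refine toeplitzNormSq_congr fun i hi => ?_
  rw [extendZero_sum _ _ _ hi]
  simp

/-- Finite-dimensional linear maps taking the standard basis to bases with uniformly bounded basis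
constants and arbitrarily large unconditional constants. -/
theorem exists_linearMap_conditional (R : ℝ) :
    ∃ (n N : ℕ) (T : EuclideanSpace ℂ (Fin n) →ₗ[ℂ] EuclideanSpace ℂ (Fin N ⊕ Fin N)),
      0 < n ∧ Function.Injective T ∧
      (∀ (α : ℕ → ℂ) (m : ℕ),
        ‖T (∑ k ∈ Finset.univ.filter (fun k : Fin n => (k : ℕ) < m), α k • EuclideanSpace.single k (1 : ℂ))‖ ^ 2 ≤
          3 * ‖T (∑ k : Fin n, α k • EuclideanSpace.single k (1 : ℂ))‖ ^ 2) ∧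
      ∃ (α : ℕ → ℂ) (S : Finset (Fin n)),
        0 < ‖T (∑ k ∈ S, α k • EuclideanSpace.single k (1 : ℂ))‖ ^ 2 ∧
        R * ‖T (∑ k : Fin n, α k • EuclideanSpace.single k (1 : ℂ))‖ ^ 2 ≤
          ‖T (∑ k ∈ S, α k • EuclideanSpace.single k (1 : ℂ))‖ ^ 2 := by
  obtain ⟨L, hLR, hL⟩ := ((Real.tendsto_sum_range_one_div_nat_succ_atTop.eventually_ge_atTop
    (4 * R)).and (eventually_gt_atTop 0)).exists
  change 4 * R ≤ harmonicSum L at hLR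
  have hL' : (0 : ℝ) < L := by exact_mod_cast hL
  have hHL := one_le_harmonicSum hL
  have hH := harmonicSum_two_mul_le L
  have hH1 := one_le_harmonicSum (N := 2 * L) (by omega)
  set N := 2 * L with hN
  -- Normalised so that the corner bound `2 * (ε ^ 2 * harmonicSum N)` equals `2`, giving the
  -- constant `3 = 1 + 2`.
  let ε : ℝ := 1 / Real.sqrt (harmonicSum N)
  have hε : ε ^ 2 * harmonicSum N = 1 := by
    simp only [ε]
    rw [div_pow, Real.sq_sqrt (by linarith)]
    field_simp
  have hε0 : 0 < ε := by
    have : 0 < Real.sqrt (harmonicSum N) := Real.sqrt_pos.2 (by linarith)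
    positivity
  let a : ℕ → ℝ := fun d => ε * (1 / ((d : ℝ) + 1))
  have hfull : ∀ α : ℕ → ℂ, ‖toeplitzMap a N (∑ k : Fin (2 * N),
      α k • EuclideanSpace.single k (1 : ℂ))‖ ^ 2 = toeplitzNormSq a N α := by
    intro α
    have := norm_toeplitzMap_sum_sq a N α (fun _ => True)
    simpa using this
  have hA : ∀ k, ∑ n ∈ Finset.range (k + 1), a (k - n) = ε * harmonicSum (k + 1) := by
    intro k
    rw [harmonicSum, ← Finset.sum_range_reflect (fun d : ℕ => 1 / ((d : ℝ) + 1)), Finset.mul_sum]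
    rfl
  -- The odd entries cancel the Toeplitz part, so the full sum has squared norm only `N`; without
  -- them each row `k ≥ L` contributes at least `(ε * harmonicSum L) ^ 2`.
  let α : ℕ → ℂ := fun i => if Even i then 1 else
    -∑ n ∈ Finset.range (i / 2 + 1), (a (i / 2 - n) : ℂ)
  have heven : ∀ k, α (2 * k) = 1 := fun k => if_pos (even_two_mul k)
  have hodd : ∀ k, toeplitzOdd a α k = 0 := by
    intro k
    have h1 : ¬ Even (2 * k + 1) := by simp
    have h2 : (2 * k + 1) / 2 = k := by omega
    have h3 : α (2 * k + 1) = -∑ n ∈ Finset.range (k + 1), (a (k - n) : ℂ) := by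
      simp only [α, if_neg h1, h2]
    rw [toeplitzOdd, h3]
    simp [heven]
  have hq : toeplitzNormSq a N α = N := by
    simp [toeplitzNormSq, heven, hodd]
  have hodd' : ∀ k, toeplitzOdd a (fun i => if Even i then α i else 0) k
      = ((ε * harmonicSum (k + 1) : ℝ) : ℂ) := by
    intro k
    have h1 : ¬ Even (2 * k + 1) := by simp
    rw [toeplitzOdd, if_neg h1, ← hA]
    simp [heven]
  have hbig : R * N ≤ toeplitzNormSq a N (fun i => if Even i then α i else 0) := by
    have hsub : ∑ k ∈ Finset.Ico L N, (ε * harmonicSum L) ^ 2 ≤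
        toeplitzNormSq a N (fun i => if Even i then α i else 0) := by
      refine (Finset.sum_le_sum (g := fun k =>
        ‖(fun i => if Even i then α i else 0) (2 * k)‖ ^ 2 +
          ‖toeplitzOdd a (fun i => if Even i then α i else 0) k‖ ^ 2) fun k hk => ?_).trans
        (Finset.sum_le_sum_of_subset_of_nonneg (fun k hk => ?_) fun _ _ _ => by positivity)
      · rw [Finset.mem_Ico] at hk
        rw [hodd', Complex.norm_real, Real.norm_eq_abs, sq_abs]
        have h1 : ε * harmonicSum L ≤ ε * harmonicSum (k + 1) :=
          mul_le_mul_of_nonneg_left (harmonicSum_mono (by omega)) hε0.le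
        have h2 := pow_le_pow_left₀ (by positivity) h1 2
        exact h2.trans (le_add_of_nonneg_left (by positivity))
      · rw [Finset.mem_Ico] at hk; exact Finset.mem_range.2 hk.2
    refine le_trans ?_ hsub
    rw [Finset.sum_const, Nat.card_Ico, hN, nsmul_eq_mul]
    have e : 2 * L - L = L := by omega
    rw [e, mul_pow]
    push_cast
    have h1 : harmonicSum N ≤ 2 * harmonicSum L := by linarith
    have h2 : harmonicSum L / 2 ≤ ε ^ 2 * harmonicSum L ^ 2 := by
      have h3 : ε ^ 2 * harmonicSum N ≤ ε ^ 2 * (2 * harmonicSum L) := by gcongr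
      rw [hε] at h3
      nlinarith
    nlinarith
  refine ⟨2 * N, N, toeplitzMap a N, by omega, toeplitzMap_injective a N, fun β m => ?_,
    α, Finset.univ.filter (fun k => Even (k : ℕ)), ?_, ?_⟩
  · rw [norm_toeplitzMap_sum_sq a N β (fun i => i < m), hfull]
    have h := toeplitzNormSq_truncate_le (a := a) (N := N) (D := 2) (fun M hM => by
      have := sum_sum_sq_le (ε := ε) hM
      rw [hε] at this
      simpa [a] using this) (by norm_num) β m
    linarith
  · rw [norm_toeplitzMap_sum_sq a N α (fun i => Even i)]
    have hpos : ∀ k ∈ Finset.range N, 0 < ‖(fun i => if Even i then α i else 0) (2 * k)‖ ^ 2 +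
          ‖toeplitzOdd a (fun i => if Even i then α i else 0) k‖ ^ 2 := by
      intro k _
      have : (0 : ℝ) < ‖(fun i => if Even i then α i else 0) (2 * k)‖ ^ 2 := by simp [heven]
      positivity
    exact Finset.sum_pos hpos ⟨0, Finset.mem_range.2 (by omega)⟩
  · rw [norm_toeplitzMap_sum_sq a N α (fun i => Even i), hfull, hq]
    exact hbig

/-! ### Orthogonality of disjoint supports. -/

theorem HilbertBasis.inner_eq_zero_of_mem_span {H : Type*} [NormedAddCommGroup H]
    [InnerProductSpace ℂ H] (b : HilbertBasis ℕ ℂ H) {S S' : Set ℕ} (hS : Disjoint S S') {y z : H}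
    (hy : y ∈ Submodule.span ℂ (b '' S)) (hz : z ∈ Submodule.span ℂ (b '' S')) :
    inner ℂ y z = 0 := by
  have h : Submodule.span ℂ (b '' S) ⟂ Submodule.span ℂ (b '' S') := by
    rw [Submodule.isOrtho_span]
    rintro _ ⟨m, hm, rfl⟩ _ ⟨n, hn, rfl⟩
    exact b.orthonormal.2 fun h => Set.disjoint_left.1 hS hm (h ▸ hn)
  exact h.inner_eq hy hz

theorem HilbertBasis.norm_add_sq_of_mem_span {H : Type*} [NormedAddCommGroup H]
    [InnerProductSpace ℂ H] (b : HilbertBasis ℕ ℂ H) {S S' : Set ℕ} (hS : Disjoint S S') {y z : H}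
    (hy : y ∈ Submodule.span ℂ (b '' S)) (hz : z ∈ Submodule.span ℂ (b '' S')) :
    ‖y + z‖ ^ 2 = ‖y‖ ^ 2 + ‖z‖ ^ 2 := by
  simp only [sq]
  exact norm_add_sq_eq_norm_sq_add_norm_sq_of_inner_eq_zero _ _
    (b.inner_eq_zero_of_mem_span hS hy hz)

theorem harmonicDiagonal_mem_span {H : Type*} [NormedAddCommGroup H]
    [InnerProductSpace ℂ H] (b : HilbertBasis ℕ ℂ H) {S : Set ℕ} {y : H}
    (hy : y ∈ Submodule.span ℂ (b '' S)) :
    harmonicDiagonal b y ∈ Submodule.span ℂ (b '' S) := by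
  induction hy using Submodule.span_induction with
  | mem y hy =>
    obtain ⟨n, hn, rfl⟩ := hy
    rw [harmonicDiagonal_apply_basis]
    exact Submodule.smul_mem _ _ (Submodule.subset_span ⟨n, hn, rfl⟩)
  | zero => simp
  | add y z _ _ hy hz => rw [map_add]; exact add_mem hy hz
  | smul c y _ hy => rw [map_smul]; exact Submodule.smul_mem _ _ hy

/-- Turns a partial sum over a block into a partial sum of the finite-dimensional model. -/
theorem StrictMono.exists_lt_iff_fin_lt {n : ℕ} {p : Fin n → ℕ} (hp : StrictMono p) (m : ℕ) :
    ∃ m' : ℕ, ∀ k, p k < m ↔ (k : ℕ) < m' := by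
  classical
  have hex : ∃ j, ∀ k : Fin n, p k < m → (k : ℕ) < j := ⟨n, fun k _ => k.2⟩
  refine ⟨Nat.find hex, fun k => ⟨Nat.find_spec hex k, fun hk => ?_⟩⟩
  by_contra h
  refine Nat.find_min hex hk fun k' hk' => ?_
  exact hp.lt_iff_lt.1 (lt_of_lt_of_le hk' (not_lt.1 h))

/-! ### Transplanting the model into a block. -/

/-- An isometric embedding of Euclidean space on which the harmonic diagonal operator has, up to
scale and a factor of two, the same norms as a given injective map. -/
theorem exists_linearIsometry_norm_equiv {H : Type*} [NormedAddCommGroup H] [InnerProductSpace ℂ H]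
    (b : HilbertBasis ℕ ℂ H) {n : ℕ} {F : Type*} [NormedAddCommGroup F]
    [InnerProductSpace ℂ F] [FiniteDimensional ℂ F] (T : EuclideanSpace ℂ (Fin n) →ₗ[ℂ] F)
    (hT : Function.Injective T) (N₀ : ℕ) :
    ∃ (I : Finset ℕ) (c : ℝ) (W : EuclideanSpace ℂ (Fin n) →ₗᵢ[ℂ] H),
      I.card = n ∧ (∀ i ∈ I, N₀ ≤ i) ∧ 0 < c ∧
      (∀ x, W x ∈ Submodule.span ℂ (b '' I)) ∧ (∀ i ∈ I, ∃ x, W x = b i) ∧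
      ∀ x, c ^ 2 * ‖T x‖ ^ 2 ≤ ‖harmonicDiagonal b (W x)‖ ^ 2 ∧
        ‖harmonicDiagonal b (W x)‖ ^ 2 ≤ 4 * (c ^ 2 * ‖T x‖ ^ 2) := by
  obtain ⟨v, s, hs, hTs⟩ := exists_orthonormalBasis_norm_sq_eq T hT
  obtain ⟨idx, c, hinj, hc, hidx⟩ := exists_injective_harmonic_approx hs N₀
  -- Right singular vectors go to basis vectors whose eigenvalues under `K` match the singular
  -- values.
  let W₀ : EuclideanSpace ℂ (Fin n) →ₗ[ℂ] H := v.toBasis.constr ℂ (fun i => b (idx i))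
  have hW₀ : ∀ i, W₀ (v i) = b (idx i) := by
    intro i
    have := v.toBasis.constr_basis ℂ (fun i => b (idx i)) i
    rwa [v.coe_toBasis] at this
  let W : EuclideanSpace ℂ (Fin n) →ₗᵢ[ℂ] H := W₀.isometryOfOrthonormal (v := v.toBasis)
    (by rw [v.coe_toBasis]; exact v.orthonormal) (by
      have h : W₀ ∘ v.toBasis = b ∘ idx := by
        rw [v.coe_toBasis]; funext i; exact hW₀ i
      rw [h]
      exact b.orthonormal.comp idx hinj)
  have hW : ∀ i, W (v i) = b (idx i) := hW₀
  have hWx : ∀ x, W x = ∑ i, inner ℂ (v i) x • b (idx i) := by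
    intro x
    conv_lhs => rw [← v.sum_repr' x]
    simp only [map_sum, map_smul, hW]
  have hnorm : ∀ x, ‖harmonicDiagonal b (W x)‖ ^ 2 =
      ∑ i, (1 / ((idx i : ℝ) + 1)) ^ 2 * ‖inner ℂ (v i) x‖ ^ 2 := by
    intro x
    let y := ∑ i, (((1 / ((idx i : ℝ) + 1) : ℝ) : ℂ) * inner ℂ (v i) x) • v i
    have hy : harmonicDiagonal b (W x) = W y := by
      rw [hWx]
      simp only [y, map_sum, map_smul, hW, harmonicDiagonal_apply_basis, smul_smul]
      refine Finset.sum_congr rfl fun i _ => ?_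
      congr 1
      push_cast
      ring
    rw [hy, W.norm_map, ← v.sum_sq_norm_inner_right y]
    refine Finset.sum_congr rfl fun i _ => ?_
    rw [v.orthonormal.inner_right_fintype, norm_mul, mul_pow, Complex.norm_real, Real.norm_eq_abs,
      sq_abs]
  refine ⟨Finset.univ.image idx, c, W, ?_, ?_, hc, ?_, ?_, fun x => ?_⟩
  · rw [Finset.card_image_of_injective _ hinj]; simp
  · intro i hi
    obtain ⟨k, -, rfl⟩ := Finset.mem_image.1 hi
    exact (hidx k).1
  · intro x
    rw [hWx]
    exact Submodule.sum_mem _ fun i _ => Submodule.smul_mem _ _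
      (Submodule.subset_span ⟨idx i, by simp, rfl⟩)
  · intro i hi
    obtain ⟨k, -, rfl⟩ := Finset.mem_image.1 hi
    exact ⟨v k, hW k⟩
  · rw [hnorm, hTs, Finset.mul_sum, Finset.mul_sum]
    have hcs : ∀ i, 0 ≤ c * s i := fun i => mul_nonneg hc.le (hs i).le
    constructor
    · refine Finset.sum_le_sum fun i _ => ?_
      rw [← mul_assoc, ← mul_pow]
      exact mul_le_mul_of_nonneg_right (pow_le_pow_left₀ (hcs i) (hidx i).2.1 2) (by positivity)
    · refine Finset.sum_le_sum fun i _ => ?_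
      have h := pow_le_pow_left₀ (by positivity) (hidx i).2.2 2
      calc _ ≤ (2 * (c * s i)) ^ 2 * ‖inner ℂ (v i) x‖ ^ 2 :=
            mul_le_mul_of_nonneg_right h (by positivity)
        _ = _ := by ring

/-- A block of an orthonormal basis whose image under the harmonic diagonal operator has a uniformly
bounded basis constant and a large unconditional constant. -/
theorem exists_conditional_block {H : Type*} [NormedAddCommGroup H] [InnerProductSpace ℂ H]
    (b : HilbertBasis ℕ ℂ H) (N₀ : ℕ) {δ : ℝ} (hδ : 0 < δ) :
    ∃ (N₁ : ℕ) (e : ℕ → H), N₀ < N₁ ∧ Orthonormal ℂ e ∧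
      (∀ n ∈ Finset.Ico N₀ N₁, e n ∈ Submodule.span ℂ (b '' Finset.Ico N₀ N₁)) ∧
      (∀ n ∈ Finset.Ico N₀ N₁, b n ∈ Submodule.span ℂ (e '' Finset.Ico N₀ N₁)) ∧
      (∀ (α : ℕ → ℂ) (m : ℕ), m ≤ N₁ →
        ‖∑ n ∈ Finset.Ico N₀ m, α n • harmonicDiagonal b (e n)‖ ^ 2 ≤
          12 * ‖∑ n ∈ Finset.Ico N₀ N₁, α n • harmonicDiagonal b (e n)‖ ^ 2) ∧
      ∃ α : ℕ → ℂ, ‖∑ n ∈ Finset.Ico N₀ N₁, α n • harmonicDiagonal b (e n)‖ ≤ δ ∧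
        ∃ S ⊆ Finset.Ico N₀ N₁, 1 ≤ ‖∑ n ∈ S, α n • harmonicDiagonal b (e n)‖ := by
  classical
  obtain ⟨n, N, T, hn, hT, hlow, α₀, S₀, hS₀, hbad⟩ := exists_linearMap_conditional (4 / δ ^ 2)
  obtain ⟨I, c, W, hI, hIN, hc, hWI, hWb, hW⟩ := exists_linearIsometry_norm_equiv b T hT N₀
  let K := harmonicDiagonal b
  let p : Fin n ↪o ℕ := I.orderEmbOfFin hI
  have hpI : ∀ k, p k ∈ I := fun k => Finset.orderEmbOfFin_mem I hI k
  have hIp : ∀ i ∈ I, ∃ k, p k = i := by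
    intro i hi
    have : i ∈ Set.range p := by rw [Finset.range_orderEmbOfFin]; exact hi
    exact this
  have hpinj : Function.Injective p := p.injective
  -- The model occupies the positions in `I`, in increasing order; every other index keeps its own
  -- `b i`, so the block fills a whole interval.
  let e : ℕ → H := Function.extend p (fun k => W (EuclideanSpace.single k (1 : ℂ))) b
  have hep : ∀ k, e (p k) = W (EuclideanSpace.single k (1 : ℂ)) :=
    fun k => hpinj.extend_apply _ _ _
  have heb : ∀ i, i ∉ I → e i = b i := by
    intro i hi
    refine Function.extend_apply' _ _ _ ?_
    rintro ⟨k, rfl⟩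
    exact hi (hpI k)
  let N₁ := I.sup id + 1
  have hIlt : ∀ i ∈ I, i < N₁ := fun i hi => Nat.lt_succ_of_le (Finset.le_sup (f := id) hi)
  have hIsub : I ⊆ Finset.Ico N₀ N₁ := fun i hi => Finset.mem_Ico.2 ⟨hIN i hi, hIlt i hi⟩
  have hN : N₀ < N₁ := lt_of_le_of_lt (hIN _ (hpI ⟨0, hn⟩)) (hIlt _ (hpI ⟨0, hn⟩))
  have hsumI : ∀ (α : ℕ → ℂ) (S : Finset (Fin n)), ∑ i ∈ S.map p.toEmbedding, α i • K (e i) =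
      K (W (∑ k ∈ S, α (p k) • EuclideanSpace.single k (1 : ℂ))) := by
    intro α S
    rw [Finset.sum_map]
    simp [hep]
  have hmap : Finset.univ.map p.toEmbedding = I := by
    ext i
    simp only [Finset.mem_map, Finset.mem_univ, true_and]
    exact ⟨fun ⟨k, hk⟩ => hk ▸ hpI k, fun hi => hIp i hi⟩
  refine ⟨N₁, e, hN, ?_, ?_, ?_, ?_, ?_⟩
  · rw [orthonormal_iff_ite]
    intro i j
    by_cases hi : i ∈ I
    · obtain ⟨k, rfl⟩ := hIp i hi
      by_cases hj : j ∈ I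
      · obtain ⟨l, rfl⟩ := hIp j hj
        rw [hep, hep, W.inner_map_map]
        have := orthonormal_iff_ite.1 (EuclideanSpace.basisFun (Fin n) ℂ).orthonormal k l
        simpa [hpinj.eq_iff] using this
      · rw [hep, heb j hj, if_neg (fun h : p k = j => hj (h ▸ hi))]
        exact b.inner_eq_zero_of_mem_span (S := I) (S' := {j}) (by simpa using hj) (hWI _)
          (Submodule.subset_span ⟨j, rfl, rfl⟩)
    · by_cases hj : j ∈ I
      · obtain ⟨l, rfl⟩ := hIp j hj
        rw [hep, heb i hi, if_neg (fun h : i = p l => hi (h ▸ hj))]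
        exact b.inner_eq_zero_of_mem_span (S := {i}) (S' := I) (by simpa using hi)
          (Submodule.subset_span ⟨i, rfl, rfl⟩) (hWI _)
      · rw [heb i hi, heb j hj]
        exact orthonormal_iff_ite.1 b.orthonormal i j
  · intro i hi
    by_cases h : i ∈ I
    · obtain ⟨k, rfl⟩ := hIp i h
      rw [hep]
      exact Submodule.span_mono (Set.image_mono (by exact_mod_cast hIsub)) (hWI _)
    · rw [heb i h]
      exact Submodule.subset_span ⟨i, hi, rfl⟩
  · intro i hi
    by_cases h : i ∈ I
    · obtain ⟨x, hx⟩ := hWb i h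
      rw [← hx, ← (EuclideanSpace.basisFun (Fin n) ℂ).sum_repr x]
      simp only [map_sum, map_smul, EuclideanSpace.basisFun_apply]
      refine Submodule.sum_mem _ fun k _ => Submodule.smul_mem _ _ (Submodule.subset_span ?_)
      exact ⟨p k, hIsub (hpI k), hep k⟩
    · rw [← heb i h]
      exact Submodule.subset_span ⟨i, hi, rfl⟩
  · intro α m hm
    have hsplit : ∀ m, m ≤ N₁ → ∑ i ∈ Finset.Ico N₀ m, α i • K (e i) =
        ∑ i ∈ I.filter (· < m), α i • K (e i) +
          ∑ i ∈ (Finset.Ico N₀ m).filter (· ∉ I), α i • K (e i) := by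
      intro m _
      rw [← Finset.sum_filter_add_sum_filter_not (Finset.Ico N₀ m) (· ∈ I)]
      congr 2
      ext i
      simp only [Finset.mem_filter, Finset.mem_Ico]
      exact ⟨fun h => ⟨h.2, h.1.2⟩, fun h => ⟨⟨hIN i h.1, h.2⟩, h.1⟩⟩
    have hA : ∀ m, ∑ i ∈ I.filter (· < m), α i • K (e i) ∈ Submodule.span ℂ (b '' I) := by
      intro m
      refine Submodule.sum_mem _ fun i hi => Submodule.smul_mem _ _ (harmonicDiagonal_mem_span b ?_)
      obtain ⟨k, rfl⟩ := hIp i (Finset.mem_filter.1 hi).1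
      rw [hep]
      exact hWI _
    have hBS : ∀ S : Finset ℕ, (∀ i ∈ S, i ∉ I) →
        ∑ i ∈ S, α i • K (e i) ∈ Submodule.span ℂ (b '' S) := by
      intro S hS
      refine Submodule.sum_mem _ fun i hi => Submodule.smul_mem _ _ (harmonicDiagonal_mem_span b ?_)
      rw [heb i (hS i hi)]
      exact Submodule.subset_span ⟨i, hi, rfl⟩
    have hpyth : ∀ m, m ≤ N₁ → ‖∑ i ∈ Finset.Ico N₀ m, α i • K (e i)‖ ^ 2 =
        ‖∑ i ∈ I.filter (· < m), α i • K (e i)‖ ^ 2 +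
          ‖∑ i ∈ (Finset.Ico N₀ m).filter (· ∉ I), α i • K (e i)‖ ^ 2 := by
      intro m hm
      rw [hsplit m hm]
      refine b.norm_add_sq_of_mem_span (Set.disjoint_left.2 fun i h1 h2 => ?_) (hA m)
        (hBS _ fun i hi => (Finset.mem_filter.1 hi).2)
      exact (Finset.mem_filter.1 (Finset.mem_coe.1 h2)).2 h1
    have hBle : ‖∑ i ∈ (Finset.Ico N₀ m).filter (· ∉ I), α i • K (e i)‖ ^ 2 ≤
        ‖∑ i ∈ (Finset.Ico N₀ N₁).filter (· ∉ I), α i • K (e i)‖ ^ 2 := by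
      have hsub : (Finset.Ico N₀ m).filter (· ∉ I) ⊆ (Finset.Ico N₀ N₁).filter (· ∉ I) :=
        Finset.filter_subset_filter _ (Finset.Ico_subset_Ico_right hm)
      rw [← Finset.sum_sdiff hsub, add_comm, b.norm_add_sq_of_mem_span
        (S := ((Finset.Ico N₀ m).filter (· ∉ I) : Finset ℕ))
        (S' := ((Finset.Ico N₀ N₁).filter (· ∉ I) \ (Finset.Ico N₀ m).filter (· ∉ I) : Finset ℕ))
        (by exact_mod_cast Finset.disjoint_sdiff)
        (hBS _ fun i hi => (Finset.mem_filter.1 hi).2)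
        (hBS _ fun i hi => (Finset.mem_filter.1 (Finset.mem_sdiff.1 hi).1).2)]
      exact le_add_of_nonneg_right (by positivity)
    let β : ℕ → ℂ := fun j => if h : j < n then α (p ⟨j, h⟩) else 0
    have hβ : ∀ S : Finset (Fin n), ∑ k ∈ S, α (p k) • EuclideanSpace.single k (1 : ℂ) =
        ∑ k ∈ S, β k • EuclideanSpace.single k (1 : ℂ) := by
      intro S
      refine Finset.sum_congr rfl fun k _ => ?_
      simp [β]
    have hAle : ‖∑ i ∈ I.filter (· < m), α i • K (e i)‖ ^ 2 ≤
        12 * ‖∑ i ∈ I.filter (· < N₁), α i • K (e i)‖ ^ 2 := by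
      obtain ⟨m', hm'⟩ := p.strictMono.exists_lt_iff_fin_lt m
      have e1 : I.filter (· < m) =
          (Finset.univ.filter (fun k : Fin n => (k : ℕ) < m')).map p.toEmbedding := by
        ext i
        simp only [Finset.mem_filter, Finset.mem_map, Finset.mem_univ, true_and]
        constructor
        · rintro ⟨h1, h2⟩
          obtain ⟨k, rfl⟩ := hIp i h1
          exact ⟨k, (hm' k).1 h2, rfl⟩
        · rintro ⟨k, h1, rfl⟩
          exact ⟨hpI k, (hm' k).2 h1⟩
      have e2 : I.filter (· < N₁) = Finset.univ.map p.toEmbedding := by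
        rw [hmap]
        exact Finset.filter_true_of_mem hIlt
      rw [e1, e2, hsumI, hsumI, hβ, hβ]
      have h1 := (hW (∑ k ∈ Finset.univ.filter (fun k : Fin n => (k : ℕ) < m'),
        β k • EuclideanSpace.single k (1 : ℂ))).2
      have h2 := (hW (∑ k : Fin n, β k • EuclideanSpace.single k (1 : ℂ))).1
      -- The constant `12` is the model's `3` times the `4` lost in comparing `K ∘ W` with `T`.
      have h3 := mul_le_mul_of_nonneg_left (hlow β m') (sq_nonneg c)
      linarith
    have h1 := hpyth m hm
    have h2 := hpyth N₁ le_rfl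
    change ‖∑ i ∈ Finset.Ico N₀ m, α i • K (e i)‖ ^ 2 ≤
      12 * ‖∑ i ∈ Finset.Ico N₀ N₁, α i • K (e i)‖ ^ 2
    have h3 : 0 ≤ ‖∑ i ∈ (Finset.Ico N₀ N₁).filter (· ∉ I), α i • K (e i)‖ ^ 2 := by positivity
    linarith
  · let x := ∑ k : Fin n, α₀ k • EuclideanSpace.single k (1 : ℂ)
    let xS := ∑ k ∈ S₀, α₀ k • EuclideanSpace.single k (1 : ℂ)
    let t := ‖K (W xS)‖
    have hc2 : 0 < c ^ 2 := by positivity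
    have ht2 : c ^ 2 * ‖T xS‖ ^ 2 ≤ t ^ 2 := (hW xS).1
    have ht0 : 0 < t := by
      have h1 : 0 < t ^ 2 := lt_of_lt_of_le (mul_pos hc2 hS₀) ht2
      exact (norm_nonneg _).lt_of_ne' (fun h => by simp [t, h] at h1)
    -- Scaling by `t⁻¹` makes the subsum have norm exactly one; the default `0` discards the filler
    -- vectors.
    let α : ℕ → ℂ := Function.extend p (fun k => (t : ℂ)⁻¹ * α₀ k) 0
    have hαp : ∀ k, α (p k) = (t : ℂ)⁻¹ * α₀ k := fun k => hpinj.extend_apply _ _ _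
    have hα0 : ∀ i, i ∉ I → α i = 0 := by
      intro i hi
      refine Function.extend_apply' _ _ _ ?_
      rintro ⟨k, rfl⟩
      exact hi (hpI k)
    have hsumα : ∀ S : Finset (Fin n), ∑ i ∈ S.map p.toEmbedding, α i • K (e i) =
        (t : ℂ)⁻¹ • K (W (∑ k ∈ S, α₀ k • EuclideanSpace.single k (1 : ℂ))) := by
      intro S
      rw [hsumI]
      simp only [hαp, mul_smul, ← Finset.smul_sum, map_smul]
    have hnt : ‖((t : ℂ)⁻¹)‖ = t⁻¹ := by
      rw [norm_inv, Complex.norm_real, Real.norm_of_nonneg ht0.le]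
    refine ⟨α, ?_, S₀.map p.toEmbedding, ?_, ?_⟩
    · have h1 : ∑ i ∈ Finset.Ico N₀ N₁, α i • K (e i) = (t : ℂ)⁻¹ • K (W x) := by
        rw [← hsumα, hmap]
        symm
        refine Finset.sum_subset hIsub fun i _ hi => ?_
        rw [hα0 i hi, zero_smul]
      change ‖∑ i ∈ Finset.Ico N₀ N₁, α i • K (e i)‖ ≤ δ
      rw [h1, norm_smul, hnt, inv_mul_le_iff₀ ht0]
      refine le_of_sq_le_sq ?_ (by positivity)
      have h2 : ‖K (W x)‖ ^ 2 ≤ 4 * (c ^ 2 * ‖T x‖ ^ 2) := (hW x).2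
      have h3 : 4 / δ ^ 2 * ‖T x‖ ^ 2 ≤ ‖T xS‖ ^ 2 := hbad
      have h4 : 4 * ‖T x‖ ^ 2 ≤ δ ^ 2 * ‖T xS‖ ^ 2 := by
        rw [div_mul_eq_mul_div, div_le_iff₀ (by positivity)] at h3
        linarith
      calc ‖K (W x)‖ ^ 2 ≤ c ^ 2 * (4 * ‖T x‖ ^ 2) := by linarith
        _ ≤ c ^ 2 * (δ ^ 2 * ‖T xS‖ ^ 2) := by gcongr
        _ = δ ^ 2 * (c ^ 2 * ‖T xS‖ ^ 2) := by ring
        _ ≤ δ ^ 2 * t ^ 2 := by gcongr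
        _ = (t * δ) ^ 2 := by ring
    · intro i hi
      obtain ⟨k, -, rfl⟩ := Finset.mem_map.1 hi
      exact hIsub (hpI k)
    · change 1 ≤ ‖∑ i ∈ S₀.map p.toEmbedding, α i • K (e i)‖
      rw [hsumα, norm_smul, hnt]
      exact (inv_mul_cancel₀ ht0.ne').ge

/-! ### Gluing the blocks. -/

theorem StrictMono.exists_le_lt_succ {N : ℕ → ℕ} (hN : StrictMono N) (h0 : N 0 = 0) (n : ℕ) :
    ∃ j, N j ≤ n ∧ n < N (j + 1) := by
  have hex : ∃ j, n < N (j + 1) := ⟨n, lt_of_lt_of_le n.lt_succ_self hN.le_apply⟩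
  refine ⟨Nat.find hex, ?_, Nat.find_spec hex⟩
  rcases h : Nat.find hex with _ | j
  · simp [h0]
  · exact not_lt.1 (Nat.find_min hex (by omega))

/-- Every vector of the algebraic span of the basis represents, after composition with the inverse
of the harmonic diagonal operator, a continuous functional. -/
theorem exists_functional_harmonicDiagonal {H : Type*} [NormedAddCommGroup H]
    [InnerProductSpace ℂ H] (b : HilbertBasis ℕ ℂ H) {y : H}
    (hy : y ∈ Submodule.span ℂ (Set.range b)) :
    ∃ g : H →L[ℂ] ℂ, ∀ x, g (harmonicDiagonal b x) = inner ℂ y x := by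
  induction hy using Submodule.span_induction with
  | mem y hy =>
    obtain ⟨n, rfl⟩ := hy
    refine ⟨((n : ℂ) + 1) • innerSL ℂ (b n), fun x => ?_⟩
    have h : ((n : ℂ) + 1) ≠ 0 := by exact_mod_cast Nat.succ_ne_zero n
    have h1 := repr_harmonicDiagonal b x n
    rw [b.repr_apply_apply, b.repr_apply_apply] at h1
    rw [smul_apply, innerSL_apply_apply, h1, smul_eq_mul, ← mul_assoc,
      mul_one_div_cancel h, one_mul]
  | zero => exact ⟨0, fun x => by simp⟩
  | add y z _ _ hy hz =>
    obtain ⟨g, hg⟩ := hy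
    obtain ⟨g', hg'⟩ := hz
    exact ⟨g + g', fun x => by rw [add_apply, hg, hg', inner_add_left]⟩
  | smul c y _ hy =>
    obtain ⟨g, hg⟩ := hy
    exact ⟨(starRingEnd ℂ c) • g, fun x => by rw [smul_apply, hg, inner_smul_left, smul_eq_mul]⟩

theorem isConditionalOperator_harmonicDiagonal {H : Type*} [NormedAddCommGroup H]
    [InnerProductSpace ℂ H] [CompleteSpace H] (b : HilbertBasis ℕ ℂ H) :
    IsConditionalOperator (harmonicDiagonal b) := by
  have hblock := fun (N₀ j : ℕ) =>
    exists_conditional_block b N₀ (δ := (1 / 2 : ℝ) ^ j) (by positivity)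
  choose nxt E hlt hEo hEb hbE hEC hEbad using hblock
  obtain ⟨N, hN0, hNs⟩ : ∃ N : ℕ → ℕ, N 0 = 0 ∧ ∀ j, N (j + 1) = nxt (N j) j :=
    ⟨fun j => Nat.rec 0 (fun j m => nxt m j) j, rfl, fun _ => rfl⟩
  have hN : StrictMono N := strictMono_nat_of_lt_succ fun j => hNs j ▸ hlt (N j) j
  choose J hJ1 hJ2 using hN.exists_le_lt_succ hN0
  have hJ : ∀ j n, N j ≤ n → n < N (j + 1) → J n = j := by
    intro j n h1 h2
    have h3 : j < J n + 1 := hN.lt_iff_lt.1 (lt_of_le_of_lt h1 (hJ2 n))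
    have h4 : J n < j + 1 := hN.lt_iff_lt.1 (lt_of_le_of_lt (hJ1 n) h2)
    omega
  -- `J n` is the block containing `n`; each block contributes only its values on its own interval.
  let e : ℕ → H := fun n => E (N (J n)) (J n) n
  have he : ∀ j, ∀ n ∈ Finset.Ico (N j) (N (j + 1)), e n = E (N j) j n := by
    intro j n hn
    rw [Finset.mem_Ico] at hn
    simp only [e, hJ j n hn.1 hn.2]
  have heIco : ∀ j l n, N j ≤ n → n < N l →
      e n ∈ Submodule.span ℂ (b '' Finset.Ico (N j) (N l)) := by
    intro j l n h1 h2
    have h3 : j ≤ J n := by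
      have : j < J n + 1 := hN.lt_iff_lt.1 (lt_of_le_of_lt h1 (hJ2 n))
      omega
    have h4 : J n + 1 ≤ l := hN.lt_iff_lt.1 (lt_of_le_of_lt (hJ1 n) h2)
    have h5 := hEb (N (J n)) (J n) n (Finset.mem_Ico.2 ⟨hJ1 n, hNs _ ▸ hJ2 n⟩)
    rw [← hNs] at h5
    refine Submodule.span_mono (Set.image_mono ?_) h5
    exact_mod_cast Finset.Ico_subset_Ico (hN.monotone h3) (hN.monotone h4)
  have heblock : ∀ n, e n ∈ Submodule.span ℂ (b '' Finset.Ico (N (J n)) (N (J n + 1))) :=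
    fun n => heIco _ _ _ (hJ1 n) (hJ2 n)
  have hIcodisj : ∀ i j, i ≠ j →
      Disjoint (Finset.Ico (N i) (N (i + 1))) (Finset.Ico (N j) (N (j + 1))) := by
    intro i j hij
    rw [Finset.disjoint_left]
    intro n hi hj
    rw [Finset.mem_Ico] at hi hj
    exact hij ((hJ i n hi.1 hi.2).symm.trans (hJ j n hj.1 hj.2))
  have hortho : Orthonormal ℂ e := by
    refine ⟨fun n => (hEo _ _).1 n, fun m n hmn => ?_⟩
    by_cases h : J m = J n
    · simp only [e, h]
      exact (hEo _ _).2 hmn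
    · exact b.inner_eq_zero_of_mem_span (by exact_mod_cast hIcodisj _ _ h) (heblock m) (heblock n)
  have hbspan : ∀ m, b m ∈ Submodule.span ℂ (Set.range e) := by
    intro m
    have h := hbE (N (J m)) (J m) m (Finset.mem_Ico.2 ⟨hJ1 m, hNs _ ▸ hJ2 m⟩)
    rw [← hNs] at h
    refine Submodule.span_mono ?_ h
    rintro _ ⟨n, hn, rfl⟩
    exact ⟨n, he (J m) n hn⟩
  have hspan : Submodule.span ℂ (Set.range b) ≤ Submodule.span ℂ (Set.range e) := by
    rw [Submodule.span_le]
    rintro _ ⟨m, rfl⟩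
    exact hbspan m
  have hsp : ⊤ ≤ (Submodule.span ℂ (Set.range e)).topologicalClosure := by
    rw [← b.dense_span]
    exact Submodule.topologicalClosure_mono hspan
  let f : ℕ → H := fun n => harmonicDiagonal b (e n)
  -- Each `b m` is a finite combination of the `e n`, and `K` only rescales it by a nonzero factor,
  -- so the span of `f` is dense.
  have hfspan : Submodule.span ℂ (Set.range b) ≤ Submodule.span ℂ (Set.range f) := by
    rw [Submodule.span_le]
    rintro _ ⟨m, rfl⟩
    have h1 : harmonicDiagonal b (b m) ∈ Submodule.span ℂ (Set.range f) := by
      have h2 := Submodule.mem_map_of_mem (f := (harmonicDiagonal b : H →ₗ[ℂ] H)) (hbspan m)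
      rw [Submodule.map_span, ← Set.range_comp] at h2
      exact h2
    rw [harmonicDiagonal_apply_basis] at h1
    have h3 : (1 / ((m : ℂ) + 1)) ≠ 0 := one_div_ne_zero (by exact_mod_cast Nat.succ_ne_zero m)
    exact (Submodule.smul_mem_iff _ h3).1 h1
  have hdense : Dense (Submodule.span ℂ (Set.range f) : Set H) := by
    rw [Submodule.dense_iff_topologicalClosure_eq_top, eq_top_iff, ← b.dense_span]
    exact Submodule.topologicalClosure_mono hfspan
  -- Each `e m` is a finite combination of the `b i`, so the coefficient functional is continuous
  -- although `K⁻¹` is unbounded.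
  have hg : ∀ m, ∃ g : H →L[ℂ] ℂ, ∀ x, g (harmonicDiagonal b x) = inner ℂ (e m) x := fun m =>
    exists_functional_harmonicDiagonal b
      (Submodule.span_mono (Set.image_subset_range _ _) (heblock m))
  choose g hg using hg
  have hgf : ∀ m n, g m (f n) = if m = n then 1 else 0 := fun m n =>
    (hg m (e n)).trans (orthonormal_iff_ite.1 hortho m n)
  have hsumIco : ∀ (α : ℕ → ℂ) (j l : ℕ) (S : Finset ℕ), S ⊆ Finset.Ico (N j) (N l) →
      ∑ n ∈ S, α n • f n ∈ Submodule.span ℂ (b '' Finset.Ico (N j) (N l)) := by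
    intro α j l S hS
    refine Submodule.sum_mem _ fun n hn => Submodule.smul_mem _ _ (harmonicDiagonal_mem_span b ?_)
    have := Finset.mem_Ico.1 (hS hn)
    exact heIco j l n this.1 this.2
  have hEsum : ∀ (α : ℕ → ℂ) (j : ℕ) (S : Finset ℕ), S ⊆ Finset.Ico (N j) (N (j + 1)) →
      ∑ n ∈ S, α n • harmonicDiagonal b (E (N j) j n) = ∑ n ∈ S, α n • f n := by
    intro α j S hS
    refine Finset.sum_congr rfl fun n hn => ?_
    rw [← he j n (hS hn)]
  -- Complete blocks are mutually orthogonal and only the block cut at `n` costs a factor `12`,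
  -- which is at most `4 ^ 2`.
  have hpart : ∀ (α : ℕ → ℂ) (n L : ℕ), n < N L →
      ‖∑ i ∈ Finset.range n, α i • f i‖ ≤ 4 * ‖∑ i ∈ Finset.range (N L), α i • f i‖ := by
    intro α n L hn
    set j := J n
    have hj : j + 1 ≤ L := hN.lt_iff_lt.1 (lt_of_le_of_lt (hJ1 n) hn)
    have hjn : N j ≤ n := hJ1 n
    have hnj : n < N (j + 1) := hJ2 n
    have hjL : N (j + 1) ≤ N L := hN.monotone hj
    have hjj : N j ≤ N (j + 1) := hjn.trans hnj.le
    set u := ∑ i ∈ Finset.Ico (N 0) (N j), α i • f i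
    set v := ∑ i ∈ Finset.Ico (N j) (N (j + 1)), α i • f i
    set v' := ∑ i ∈ Finset.Ico (N j) n, α i • f i
    set w := ∑ i ∈ Finset.Ico (N (j + 1)) (N L), α i • f i
    have hu := hsumIco α 0 j _ subset_rfl
    have hv := hsumIco α j (j + 1) _ subset_rfl
    have hv' := hsumIco α j (j + 1) _ (Finset.Ico_subset_Ico_right hnj.le : Finset.Ico (N j) n ⊆ _)
    have hw := hsumIco α (j + 1) L _ subset_rfl
    have huv := hsumIco α 0 (j + 1) _ subset_rfl
    have e1 : ∑ i ∈ Finset.range n, α i • f i = u + v' := by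
      rw [Finset.range_eq_Ico, ← hN0]
      exact (Finset.sum_Ico_consecutive _ (hN.monotone (Nat.zero_le j)) hjn).symm
    have e2 : ∑ i ∈ Finset.Ico (N 0) (N (j + 1)), α i • f i = u + v :=
      (Finset.sum_Ico_consecutive _ (hN.monotone (Nat.zero_le j)) hjj).symm
    have e3 : ∑ i ∈ Finset.range (N L), α i • f i = (u + v) + w := by
      rw [Finset.range_eq_Ico, ← hN0, ← e2]
      exact (Finset.sum_Ico_consecutive _ (hN.monotone (Nat.zero_le (j + 1))) hjL).symm
    rw [e2] at huv
    have hd1 := Finset.Ico_disjoint_Ico_consecutive (N 0) (N j) (N (j + 1))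
    have hd2 := Finset.Ico_disjoint_Ico_consecutive (N 0) (N (j + 1)) (N L)
    have n1 : ‖u + v'‖ ^ 2 = ‖u‖ ^ 2 + ‖v'‖ ^ 2 :=
      b.norm_add_sq_of_mem_span (by exact_mod_cast hd1) hu hv'
    have n2 : ‖u + v‖ ^ 2 = ‖u‖ ^ 2 + ‖v‖ ^ 2 :=
      b.norm_add_sq_of_mem_span (by exact_mod_cast hd1) hu hv
    have n3 : ‖u + v + w‖ ^ 2 = ‖u + v‖ ^ 2 + ‖w‖ ^ 2 :=
      b.norm_add_sq_of_mem_span (by exact_mod_cast hd2) huv hw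
    have n4 : ‖v'‖ ^ 2 ≤ 12 * ‖v‖ ^ 2 := by
      have h := hEC (N j) j α n (hNs j ▸ hnj.le)
      rw [← hNs, hEsum _ _ _ (Finset.Ico_subset_Ico_right hnj.le), hEsum _ _ _ subset_rfl] at h
      exact h
    rw [e1, e3]
    refine le_of_sq_le_sq ?_ (by positivity)
    rw [mul_pow]
    nlinarith [sq_nonneg ‖u‖, sq_nonneg ‖w‖, sq_nonneg ‖v‖]
  have hC : ∀ (α : ℕ → ℂ) (n n' : ℕ), n ≤ n' →
      ‖∑ i ∈ Finset.range n, α i • f i‖ ≤ 4 * ‖∑ i ∈ Finset.range n', α i • f i‖ := by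
    intro α n n' hn
    have hn' : n' < N (n' + 1) := lt_of_lt_of_le n'.lt_succ_self hN.le_apply
    -- Zeroing the coefficients from `n'` on reduces an arbitrary endpoint to the end of a block.
    have h := hpart (fun i => if i < n' then α i else 0) n (n' + 1) (by omega)
    have e1 : ∑ i ∈ Finset.range n, (if i < n' then α i else 0) • f i =
        ∑ i ∈ Finset.range n, α i • f i := by
      refine Finset.sum_congr rfl fun i hi => ?_
      rw [if_pos (lt_of_lt_of_le (Finset.mem_range.1 hi) hn)]
    have e2 : ∑ i ∈ Finset.range (N (n' + 1)), (if i < n' then α i else 0) • f i =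
        ∑ i ∈ Finset.range n', α i • f i := by
      simp only [ite_smul, zero_smul]
      rw [← Finset.sum_filter]
      congr 1
      ext i
      simp only [Finset.mem_filter, Finset.mem_range]
      omega
    rwa [e1, e2] at h
  refine ⟨HilbertBasis.mk hortho hsp, ?_⟩
  rw [HilbertBasis.coe_mk]
  refine ⟨isSchauderBasis_of_biorthogonal hgf hdense hC,
    not_isUnconditionalBasis_of_biorthogonal hgf hdense hC
      (B := fun j => Finset.Ico (N j) (N (j + 1))) hIcodisj
      (fun j n hn => hN.le_apply.trans (Finset.mem_Ico.1 hn).1) fun j => ?_⟩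
  obtain ⟨α, hα, S, hS, hS1⟩ := hEbad (N j) j
  rw [← hNs] at hα hS
  rw [hEsum _ _ _ subset_rfl] at hα
  rw [hEsum _ _ _ hS] at hS1
  exact ⟨α, hα, S, hS, hS1⟩

theorem mainTheorem3 {H : Type*} [NormedAddCommGroup H] [InnerProductSpace ℂ H]
    [CompleteSpace H] (b : HilbertBasis ℕ ℂ H) :
    IsCompactOperator (harmonicDiagonal b) ∧ IsConditionalOperator (harmonicDiagonal b) :=
  ⟨isCompactOperator_harmonicDiagonal b, isConditionalOperator_harmonicDiagonal b⟩
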